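/- Let $K$ be a field of characteristic $0$ and $d\ge 2$. Let $G_d$ be the algebra with basis $x_1,\dots,x_d$ together with all monomials $Y^aZ^b=y_1^{a_1}\cdots y_d^{a_d}z_1^{b_1}\cdots z_d^{b_d}$ with $|a|,|b|\ge 1$, and multiplication \[ x_ix_j=y_iz_j,\quad x_i(Y^aZ^b)=y_iY^aZ^b,\quad (Y^aZ^b)x_i=Y^aZ^bz_i,\quad (Y^aZ^b)(Y^{a'}Z^{b'})=Y^{a+a'}Z^{b+b'} \] (a model of the free algebra of rank $d$ in the variety of bicommutative algebras, i.e. algebras with $(uv)w=(uw)v$ and $u(vw)=v(uw)$), graded by $\deg x_i=1$, $\deg Y^aZ^b=|a|+|b|$. A T-ideal of an algebra is a two-sided ideal, closed under scalars, that is stable under all endomorphisms of the algebra. The consequences of a set of elements are the elements of the T-ideal it generates, and two sets are equivalent if they generate the same T-ideal. Let $\alpha_1,\alpha_2\in K$ satisfy $\alpha_1\alpha_2(\alpha_1+\alpha_2)(\alpha_1-\alpha_2)\neq 0$, and let $G_d(\mathfrak U_\alpha)$ be the factor algebra of $G_d$ modulo the T-ideal generated by $\alpha_1x_1(x_1x_1)+\alpha_2(x_1x_1)x_1$,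 with the induced homogeneous components. Denote by the same symbols the images in $G_d(\mathfrak U_\alpha)$ of the highest weight vectors \[ w_{(1)}=x_1,\quad w_{(2)}^{(1)}=y_1z_1,\quad w_{(1^2)}^{(0)}=y_1z_2-y_2z_1, \] \[ w_{(3)}^{(2)}=y_1^2z_1,\quad w_{(2,1)}^{(1)}=y_1(y_1z_2-y_2z_1),\quad w_{(2,1)}^{(0)}=(y_1z_2-y_2z_1)z_1 . \] Then the homogeneous components of $G_d(\mathfrak U_\alpha)$ of all degrees $n\ge 4$ are zero, and in $G_d(\mathfrak U_\alpha)$: (i) the set of consequences of degree $2$ of $w_{(1)}$ is equivalent to $\{w_{(2)}^{(1)},\,w_{(1^2)}^{(0)}\}$; (ii) the set of consequences of degree $3$ of $w_{(2)}^{(1)}$ is equivalent to $\{w_{(3)}^{(2)},\,w_{(2,1)}^{(1)},\,w_{(2,1)}^{(0)}\}$; (iii) the set of consequences of degree $3$ of $w_{(1^2)}^{(0)}$ is equivalent to $\{w_{(3)}^{(2)},\,w_{(2,1)}^{(1)},\,w_{(2,1)}^{(0)}\}$. Moreover, for $n=1,2$, if $f$ is a polynomial of degree $n$ in $G_d(\mathfrak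 U_\alpha)$ (a nonzero homogeneous element of degree $n$ plus terms of lower degree), then every homogeneous element of degree $n+1$ of $G_d(\mathfrak U_\alpha)$ is a consequence of $f$. (iv) The polynomial $w_{(3)}^{(2)}$ and every polynomial $\beta_1w_{(2,1)}^{(1)}+\beta_2w_{(2,1)}^{(0)}$ with $\beta_1,\beta_2\in K$, $(\beta_1,\beta_2)\ne(0,0)$, have no nonzero consequences of degree $4$. -/

import Mathlib

open MvPolynomial

/-! ### T-ideals of a (not necessarily associative, not necessarily unital) algebra -/

section TIdeal

variable (K : Type*) [Field K] {A : Type*} [NonUnitalNonAssocRing A] [Module K A]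

/-- A T-ideal: a two-sided ideal (and subspace) stable under all algebra endomorphisms. -/
structure IsTIdeal (I : Submodule K A) : Prop where
  mul_mem_left : ∀ a b : A, b ∈ I → a * b ∈ I
  mul_mem_right : ∀ a b : A, a ∈ I → a * b ∈ I
  map_mem : ∀ (φ : A →ₙₐ[K] A) (a : A), a ∈ I → φ a ∈ I

/-- The T-ideal generated by a set `S`; its elements are the consequences of the
identities `s = 0`, `s ∈ S`. -/
def tIdeal (S : Set A) : Submodule K A :=
  sInf {I | IsTIdeal K I ∧ S ⊆ I}

theorem isTIdeal_tIdeal (S : Set A) : IsTIdeal K (tIdeal K S) where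
  mul_mem_left a b hb := by
    rw [tIdeal, Submodule.mem_sInf] at hb ⊢
    exact fun I hI => hI.1.mul_mem_left a b (hb I hI)
  mul_mem_right a b hb := by
    rw [tIdeal, Submodule.mem_sInf] at hb ⊢
    exact fun I hI => hI.1.mul_mem_right a b (hb I hI)
  map_mem φ a ha := by
    rw [tIdeal, Submodule.mem_sInf] at ha ⊢
    exact fun I hI => hI.1.map_mem φ a (ha I hI)

theorem subset_tIdeal (S : Set A) : S ⊆ tIdeal K S := by
  intro s hs
  rw [SetLike.mem_coe, tIdeal, Submodule.mem_sInf]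
  exact fun I hI => hI.2 hs

/-- The factor algebra of `A` modulo the T-ideal generated by `S`. -/
def FactorAlg (S : Set A) : Type _ := A ⧸ tIdeal K S

namespace FactorAlg

variable (S : Set A)

noncomputable instance : AddCommGroup (FactorAlg K S) :=
  inferInstanceAs (AddCommGroup (A ⧸ tIdeal K S))

noncomputable instance : Module K (FactorAlg K S) :=
  inferInstanceAs (Module K (A ⧸ tIdeal K S))

/-- The canonical projection onto the factor algebra. -/
def mk : A →ₗ[K] FactorAlg K S := (tIdeal K S).mkQ

theorem mk_surjective : Function.Surjective (mk K S) := (tIdeal K S).mkQ_surjective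

theorem mk_eq_mk {a b : A} : mk K S a = mk K S b ↔ a - b ∈ tIdeal K S :=
  Submodule.Quotient.eq _

noncomputable instance : Mul (FactorAlg K S) where
  mul := Quotient.map₂ (fun a b : A => a * b) (by
    intro a a' ha b b' hb
    have ha' : a - a' ∈ tIdeal K S := (Submodule.quotientRel_def _).1 ha
    have hb' : b - b' ∈ tIdeal K S := (Submodule.quotientRel_def _).1 hb
    refine (Submodule.quotientRel_def _).2 ?_
    have h : a * b - a' * b' = (a - a') * b + a' * (b - b') := by
      rw [sub_mul, mul_sub]; abel
    rw [h]
    exact add_mem ((isTIdeal_tIdeal K S).mul_mem_right _ _ ha')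
      ((isTIdeal_tIdeal K S).mul_mem_left _ _ hb'))

theorem mk_mul (a b : A) : mk K S (a * b) = mk K S a * mk K S b := rfl

noncomputable instance : NonUnitalNonAssocRing (FactorAlg K S) :=
  { (inferInstance : AddCommGroup (FactorAlg K S)),
    (inferInstance : Mul (FactorAlg K S)) with
    left_distrib := by
      intro a b c
      obtain ⟨a, rfl⟩ := mk_surjective K S a
      obtain ⟨b, rfl⟩ := mk_surjective K S b
      obtain ⟨c, rfl⟩ := mk_surjective K S c
      change mk K S a * (mk K S b + mk K S c) = mk K S a * mk K S b + mk K S a * mk K S c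
      rw [← map_add, ← mk_mul, ← mk_mul, ← mk_mul, ← map_add, mul_add]
    right_distrib := by
      intro a b c
      obtain ⟨a, rfl⟩ := mk_surjective K S a
      obtain ⟨b, rfl⟩ := mk_surjective K S b
      obtain ⟨c, rfl⟩ := mk_surjective K S c
      change (mk K S a + mk K S b) * mk K S c = mk K S a * mk K S c + mk K S b * mk K S c
      rw [← map_add, ← mk_mul, ← mk_mul, ← mk_mul, ← map_add, add_mul]
    zero_mul := by
      intro a
      obtain ⟨a, rfl⟩ := mk_surjective K S a
      change mk K S (0 * a) = 0
      rw [zero_mul, map_zero]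
    mul_zero := by
      intro a
      obtain ⟨a, rfl⟩ := mk_surjective K S a
      change mk K S (a * 0) = 0
      rw [mul_zero, map_zero] }

instance [IsScalarTower K A A] : IsScalarTower K (FactorAlg K S) (FactorAlg K S) where
  smul_assoc k a b := by
    obtain ⟨a, rfl⟩ := mk_surjective K S a
    obtain ⟨b, rfl⟩ := mk_surjective K S b
    simp only [smul_eq_mul, ← map_smul, ← mk_mul, smul_mul_assoc]

instance [SMulCommClass K A A] : SMulCommClass K (FactorAlg K S) (FactorAlg K S) where
  smul_comm k a b := by
    obtain ⟨a, rfl⟩ := mk_surjective K S a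
    obtain ⟨b, rfl⟩ := mk_surjective K S b
    simp only [smul_eq_mul, ← map_smul, ← mk_mul, mul_smul_comm]

end FactorAlg

end TIdeal

/-! ### The free bicommutative algebra `G_d` -/

/-- The polynomial algebra `K[y_1, …, y_d, z_1, …, z_d]`. -/
abbrev YZ (K : Type*) [Field K] (d : ℕ) := MvPolynomial (Fin d ⊕ Fin d) K

section BicommutativeAlgebra

variable (K : Type*) [Field K] (d : ℕ)

/-- The variable `y_i`. -/
noncomputable def yv (i : Fin d) : YZ K d := X (Sum.inl i)

/-- The variable `z_i`. -/
noncomputable def zv (i : Fin d) : YZ K d := X (Sum.inr i)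

/-- The span of the monomials `Y^α Z^β` with `|α|, |β| ≥ 1`, as the product of the ideals
`(y_1, …, y_d)` and `(z_1, …, z_d)` of `K[Y, Z]`. -/
noncomputable def omegaYZ : Ideal (YZ K d) :=
  Ideal.span (Set.range (yv K d)) * Ideal.span (Set.range (zv K d))

/-- The vector space with basis `x_1, …, x_d` and all `Y^α Z^β` with `|α|, |β| ≥ 1`:
a pair `(v, p)` stands for `∑ v_i x_i + p`. -/
def GAlg : Type _ := (Fin d → K) × omegaYZ K d

namespace GAlg

noncomputable instance : AddCommGroup (GAlg K d) :=
  inferInstanceAs (AddCommGroup ((Fin d → K) × omegaYZ K d))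

noncomputable instance : Module K (GAlg K d) :=
  inferInstanceAs (Module K ((Fin d → K) × omegaYZ K d))

variable {K d}

/-- The coefficients of `x_1, …, x_d`. -/
noncomputable def lin : GAlg K d →ₗ[K] (Fin d → K) := LinearMap.fst K (Fin d → K) (omegaYZ K d)

/-- The part in the square of the algebra, a polynomial in `Y, Z`. -/
noncomputable def poly : GAlg K d →ₗ[K] YZ K d :=
  ((omegaYZ K d).restrictScalars K).subtype ∘ₗ LinearMap.snd K (Fin d → K) (omegaYZ K d)

theorem poly_mem (a : GAlg K d) : poly a ∈ omegaYZ K d := a.2.2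

@[ext] theorem ext {a b : GAlg K d} (h₁ : lin a = lin b) (h₂ : poly a = poly b) : a = b :=
  Prod.ext h₁ (Subtype.ext h₂)

/-- An element of the ideal of `K[Y, Z]`, seen as an element of the algebra. -/
noncomputable def ofPoly (p : YZ K d) (hp : p ∈ omegaYZ K d) : GAlg K d := (0, ⟨p, hp⟩)

/-- The generator `x_i`. -/
noncomputable def x (i : Fin d) : GAlg K d := (Pi.single i 1, 0)

/-- The polynomial by which an element acts by left multiplication: `x_i` acts as `y_i`, and
`Y^α Z^β` as itself. -/
noncomputable def leftPoly : GAlg K d →ₗ[K] YZ K d :=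
  (Fintype.linearCombination K (yv K d)) ∘ₗ lin + poly

/-- The polynomial by which an element acts by right multiplication: `x_i` acts as `z_i`, and
`Y^α Z^β` as itself. -/
noncomputable def rightPoly : GAlg K d →ₗ[K] YZ K d :=
  (Fintype.linearCombination K (zv K d)) ∘ₗ lin + poly

theorem leftPoly_mem (a : GAlg K d) : leftPoly a ∈ Ideal.span (Set.range (yv K d)) := by
  have h := Ideal.mul_le_left (poly_mem a)
  rw [leftPoly, LinearMap.add_apply, LinearMap.comp_apply, Fintype.linearCombination_apply]
  refine Ideal.add_mem _ ?_ h
  refine sum_mem fun i _ => ?_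
  rw [MvPolynomial.smul_eq_C_mul]
  exact Ideal.mul_mem_left _ _ (Ideal.subset_span ⟨i, rfl⟩)

theorem rightPoly_mem (a : GAlg K d) : rightPoly a ∈ Ideal.span (Set.range (zv K d)) := by
  have h := Ideal.mul_le_right (poly_mem a)
  rw [rightPoly, LinearMap.add_apply, LinearMap.comp_apply, Fintype.linearCombination_apply]
  refine Ideal.add_mem _ ?_ h
  refine sum_mem fun i _ => ?_
  rw [MvPolynomial.smul_eq_C_mul]
  exact Ideal.mul_mem_left _ _ (Ideal.subset_span ⟨i, rfl⟩)

/-- The multiplication: `x_i x_j = y_i z_j`, `x_i (Y^α Z^β) = y_i Y^α Z^β`,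
`(Y^α Z^β) x_i = Y^α Z^β z_i`, and the polynomial product on the `Y^α Z^β`. -/
noncomputable instance : Mul (GAlg K d) where
  mul a b := ofPoly (leftPoly a * rightPoly b)
    (Ideal.mul_mem_mul (leftPoly_mem a) (rightPoly_mem b))

@[simp] theorem lin_mul (a b : GAlg K d) : lin (a * b) = 0 := rfl

@[simp] theorem poly_mul (a b : GAlg K d) : poly (a * b) = leftPoly a * rightPoly b := rfl

@[simp] theorem lin_ofPoly (p : YZ K d) (hp) : lin (ofPoly p hp) = 0 := rfl

@[simp] theorem poly_ofPoly (p : YZ K d) (hp) : poly (ofPoly p hp) = p := rfl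

@[simp] theorem leftPoly_mul (a b : GAlg K d) :
    leftPoly (a * b) = leftPoly a * rightPoly b := by
  simp [leftPoly, rightPoly]

@[simp] theorem rightPoly_mul (a b : GAlg K d) :
    rightPoly (a * b) = leftPoly a * rightPoly b := by
  simp [leftPoly, rightPoly]

@[simp] theorem leftPoly_x (i : Fin d) : leftPoly (x i : GAlg K d) = yv K d i := by
  change Fintype.linearCombination K (yv K d) (Pi.single i 1) + 0 = _
  simp

@[simp] theorem rightPoly_x (i : Fin d) : rightPoly (x i : GAlg K d) = zv K d i := by
  change Fintype.linearCombination K (zv K d) (Pi.single i 1) + 0 = _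
  simp

noncomputable instance : NonUnitalNonAssocRing (GAlg K d) :=
  { (inferInstance : AddCommGroup (GAlg K d)),
    (inferInstance : Mul (GAlg K d)) with
    left_distrib := by
      intro a b c
      change a * (b + c) = a * b + a * c
      ext1 <;> simp [mul_add]
    right_distrib := by
      intro a b c
      change (a + b) * c = a * c + b * c
      ext1 <;> simp [add_mul]
    zero_mul := by
      intro a
      change (0 : GAlg K d) * a = 0
      ext1 <;> simp
    mul_zero := by
      intro a
      change a * (0 : GAlg K d) = 0
      ext1 <;> simp }

instance : IsScalarTower K (GAlg K d) (GAlg K d) where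
  smul_assoc k a b := by ext1 <;> simp

instance : SMulCommClass K (GAlg K d) (GAlg K d) where
  smul_comm k a b := by ext1 <;> simp

theorem right_comm (a b c : GAlg K d) : (a * b) * c = (a * c) * b := by
  ext1
  · simp
  · simp only [poly_mul, leftPoly_mul]; ring

theorem left_comm (a b c : GAlg K d) : a * (b * c) = b * (a * c) := by
  ext1
  · simp
  · simp only [poly_mul, rightPoly_mul]; ring

variable (K d) in
/-- The homogeneous component of degree `n`, where each `x_i` has degree `1` and `Y^α Z^β` has
degree `|α| + |β|`. -/
def homog (n : ℕ) : Submodule K (GAlg K d) where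
  carrier := {a | (n ≠ 1 → lin a = 0) ∧ (poly a).IsHomogeneous n}
  zero_mem' := ⟨fun _ => map_zero _, by rw [map_zero]; exact isHomogeneous_zero _ _ _⟩
  add_mem' {a b} ha hb := ⟨fun h => by rw [map_add, ha.1 h, hb.1 h, add_zero], by
    rw [map_add]; exact ha.2.add hb.2⟩
  smul_mem' k a ha := ⟨fun h => by rw [map_smul, ha.1 h, smul_zero], by
    rw [map_smul]
    exact (homogeneousSubmodule (Fin d ⊕ Fin d) K n).smul_mem k ha.2⟩

/-- The first variable index. -/
def i₁ (hd : 2 ≤ d) : Fin d := ⟨0, by omega⟩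

/-- The second variable index. -/
def i₂ (hd : 2 ≤ d) : Fin d := ⟨1, by omega⟩

variable (K)

/-- The polynomial `y_1^j (y_1 z_2 - y_2 z_1)^{l₂} z_1^{l₁ - l₂ - j}`. -/
noncomputable def hwvPoly (hd : 2 ≤ d) (l₁ l₂ j : ℕ) : YZ K d :=
  yv K d (i₁ hd) ^ j *
    (yv K d (i₁ hd) * zv K d (i₂ hd) - yv K d (i₂ hd) * zv K d (i₁ hd)) ^ l₂ *
    zv K d (i₁ hd) ^ (l₁ - l₂ - j)

theorem hwvPoly_mem (hd : 2 ≤ d) {l₁ l₂ j : ℕ}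
    (h : (l₂ = 0 ∧ 1 ≤ j ∧ j + 1 ≤ l₁) ∨ (1 ≤ l₂ ∧ l₂ + j ≤ l₁)) :
    hwvPoly K hd l₁ l₂ j ∈ omegaYZ K d := by
  have hyz : ∀ i k, yv K d i * zv K d k ∈ omegaYZ K d := fun i k =>
    Ideal.mul_mem_mul (Ideal.subset_span ⟨i, rfl⟩) (Ideal.subset_span ⟨k, rfl⟩)
  rcases h with ⟨rfl, hj, hl⟩ | ⟨hl, -⟩
  · rw [hwvPoly, pow_zero, mul_one]
    exact Ideal.mul_mem_mul
      (Ideal.pow_mem_of_mem _ (Ideal.subset_span (Set.mem_range_self _)) _ (by omega))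
      (Ideal.pow_mem_of_mem _ (Ideal.subset_span (Set.mem_range_self _)) _ (by omega))
  · exact Ideal.mul_mem_right _ _ (Ideal.mul_mem_left _ _
      (Ideal.pow_mem_of_mem _ (sub_mem (hyz _ _) (hyz _ _)) _ (by omega)))

/-- The highest weight vector `w_λ^{(j)}` of `G_d`, `λ = (l₁, l₂)`, `l₁ + l₂ ≥ 2`: here
`1 ≤ j ≤ l₁ - 1` if `l₂ = 0` and `0 ≤ j ≤ l₁ - l₂` if `l₂ > 0`. -/
noncomputable def hwv (hd : 2 ≤ d) (l₁ l₂ j : ℕ)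
    (h : (l₂ = 0 ∧ 1 ≤ j ∧ j + 1 ≤ l₁) ∨ (1 ≤ l₂ ∧ l₂ + j ≤ l₁)) : GAlg K d :=
  ofPoly (hwvPoly K hd l₁ l₂ j) (hwvPoly_mem K hd h)

/-- The identity `α₁ x(xx) + α₂ (xx)x` in the variable `x = x_1`. -/
noncomputable def ident3 (hd : 2 ≤ d) (α₁ α₂ : K) : GAlg K d :=
  α₁ • (x (i₁ hd) * (x (i₁ hd) * x (i₁ hd))) + α₂ • ((x (i₁ hd) * x (i₁ hd)) * x (i₁ hd))

end GAlg

/-- The algebra `G_d(𝔘_α)`: the factor algebra of `G_d` modulo the T-ideal generated by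
`α₁ x(xx) + α₂ (xx)x`. -/
abbrev GU {d : ℕ} (hd : 2 ≤ d) (α₁ α₂ : K) : Type _ :=
  FactorAlg K ({GAlg.ident3 K hd α₁ α₂} : Set (GAlg K d))

namespace GU

variable {K d} (hd : 2 ≤ d) (α₁ α₂ : K)

/-- The image in `G_d(𝔘_α)` of an element of `G_d`. -/
noncomputable def mk : GAlg K d →ₗ[K] GU K hd α₁ α₂ := FactorAlg.mk K _

/-- The homogeneous component of degree `n` of `G_d(𝔘_α)`. -/
noncomputable def homog (n : ℕ) : Submodule K (GU K hd α₁ α₂) := (GAlg.homog K d n).map (mk hd α₁ α₂)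

/-- `f` is a polynomial of degree `n` in `G_d(𝔘_α)`: a nonzero homogeneous element of degree `n`
plus terms of lower degree. -/
def HasDegree (n : ℕ) (f : GU K hd α₁ α₂) : Prop :=
  ∃ g ∈ homog hd α₁ α₂ n, g ≠ 0 ∧ ∃ h ∈ ⨆ m ∈ Set.Iio n, homog hd α₁ α₂ m, f = g + h

/-- The image in `G_d(𝔘_α)` of the generator `x_1`, the highest weight vector `w_{(1)}`. -/
noncomputable def w1 : GU K hd α₁ α₂ := mk hd α₁ α₂ (GAlg.x (GAlg.i₁ hd))

/-- The image in `G_d(𝔘_α)` of the highest weight vector `w_λ^{(j)}`, `λ = (l₁, l₂)`. -/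
noncomputable def w (l₁ l₂ j : ℕ)
    (h : (l₂ = 0 ∧ 1 ≤ j ∧ j + 1 ≤ l₁) ∨ (1 ≤ l₂ ∧ l₂ + j ≤ l₁)) : GU K hd α₁ α₂ :=
  mk hd α₁ α₂ (GAlg.hwv K hd l₁ l₂ j h)

variable {hd α₁ α₂}

/-- The set of consequences of degree `n` in `G_d(𝔘_α)` of the polynomial `f`. -/
noncomputable def consequences (f : GU K hd α₁ α₂) (n : ℕ) : Submodule K (GU K hd α₁ α₂) :=
  tIdeal K {f} ⊓ homog hd α₁ α₂ n

/-- Two systems of polynomials are equivalent (as polynomial identities) if each consists of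
consequences of the other. -/
def Equivalent (S S' : Set (GU K hd α₁ α₂)) : Prop := tIdeal K S = tIdeal K S'

end GU

end BicommutativeAlgebra

/-! The product of `GAlg` is `leftPoly a * rightPoly b`, so the polynomial parts of a T-ideal form
an ideal of the commutative ring K[Y, Z] (`polyIdeal`). This ideal is stable under the substitutions
y_i ↦ `leftPoly (u i)`, z_i ↦ `rightPoly (u i)`, because any choice of images of the generators
defines an endomorphism (`endo`). Everything thus becomes commutative algebra in the quotient of
K[Y, Z] by this ideal.

The defining identity reads α₁y²z + α₂yz². Its polarization is evaluated at three generators, and at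
two generators and a product, which acts by the same polynomial y_k z_l on both sides. Together
these relations kill every monomial of degree 4 (`quartic_eq_zero`), hence all higher degrees; (iv)
follows at once.

In the lower degrees every claim says that some T-ideal contains a whole homogeneous component. Any
nonzero quadratic element specializes either to the square y_k z_k or to the commutator
(`homog_three_le_of_homog_two`). Squares give degree 3 by a symmetry argument. Commutators together
with the identity give it because all cubic monomials on three given indices coincide and α₁ + α₂ ≠
0. Pulling T-ideals back along the projection (`IsTIdeal.comap_mk`) transfers all this to the factor
algebra. -/

open MvPolynomial

/-! ### Linear relations between cubic and quartic monomials in a commutative algebra. -/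

section QuarticRelations

variable {K R ι : Type*} [Field K] [CommRing R] [Algebra K R]

/-- The full polarization of `yz(ay + bz)`. -/
def polarCubic (a b y₁ y₂ y₃ z₁ z₂ z₃ : R) : R :=
  a * (y₁ * y₂ * z₃ + y₁ * y₃ * z₂ + y₂ * y₃ * z₁) +
    b * (y₁ * z₂ * z₃ + y₂ * z₁ * z₃ + y₃ * z₁ * z₂)

theorem eq_zero_of_algebraMap_mul {c : K} (hc : c ≠ 0) {r : R} (h : algebraMap K R c * r = 0) :
    r = 0 := by
  rwa [← Algebra.smul_def, smul_eq_zero_iff_right hc] at h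

/-- The relations are symmetrized over i, j, k with l kept apart. Let A = y_i y_j y_k z_l, and let C
and D be the sums of the monomials with two y's and two z's in which l sits on a z, respectively on
a y. The other orbit sums can be eliminated. What remains is 3aA + (a + 2b)C = 0, aC + bD = 0 and bC
+ aD = 0; the last two kill C because a² ≠ b², and then A vanishes. -/
theorem yyyz_eq_zero [CharZero K] {α₁ α₂ : K} (h₁ : α₁ ≠ 0) (h₂ : α₁ ^ 2 - α₂ ^ 2 ≠ 0)
    {y z : ι → R}
    (hP : ∀ i j k, polarCubic (algebraMap K R α₁) (algebraMap K R α₂)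
      (y i) (y j) (y k) (z i) (z j) (z k) = 0)
    (hQ : ∀ i j k l, polarCubic (algebraMap K R α₁) (algebraMap K R α₂)
      (y i) (y j) (y k * z l) (z i) (z j) (y k * z l) = 0) (i j k l : ι) :
    y i * y j * y k * z l = 0 := by
  refine eq_zero_of_algebraMap_mul (K := K) (c := 3 * α₁ * (α₁ ^ 2 - α₂ ^ 2))
    (mul_ne_zero (mul_ne_zero three_ne_zero h₁) h₂) ?_
  simp only [polarCubic] at hP hQ
  simp only [map_mul, map_sub, map_pow, map_ofNat]
  generalize algebraMap K R α₁ = a at *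
  generalize algebraMap K R α₂ = b at *
  -- `r₁`, `r₂`, `r₃` come from the cubic relation times a variable, `r₅` and `r₇` from the relation
  -- with a product inserted.
  have r₁ : a * (y j * y k * y l * z i + y i * y k * y l * z j + y i * y j * y l * z k) +
      b * (y i * y l * z j * z k + y j * y l * z i * z k + y k * y l * z i * z j) = 0 := by
    linear_combination y l * hP i j k
  have r₂ : a * (3 * (y i * y j * y k * z l) +
        2 * (y j * y k * y l * z i + y i * y k * y l * z j + y i * y j * y l * z k)) +
      b * (2 * (y i * y j * z k * z l + y i * y k * z j * z l + y j * y k * z i * z l) +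
        (y i * y l * z j * z k + y j * y l * z i * z k + y k * y l * z i * z j)) = 0 := by
    linear_combination y k * hP i j l + y j * hP i k l + y i * hP j k l
  have r₃ : a * (y i * y j * z k * z l + y i * y k * z j * z l + y j * y k * z i * z l) +
      b * (y i * z j * z k * z l + y j * z i * z k * z l + y k * z i * z j * z l) = 0 := by
    linear_combination z l * hP i j k
  have r₅ : 3 * a * (y i * y j * y k * z l) +
      2 * (a + b) * (y i * y j * z k * z l + y i * y k * z j * z l + y j * y k * z i * z l) +
      b * (y i * z j * z k * z l + y j * z i * z k * z l + y k * z i * z j * z l) = 0 := by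
    linear_combination hQ i j k l + hQ i k j l + hQ j k i l
  have r₇ : 2 * a * (y j * y k * y l * z i + y i * y k * y l * z j + y i * y j * y l * z k) +
      2 * (a + b) * (y i * y j * z k * z l + y i * y k * z j * z l + y j * y k * z i * z l) +
      2 * (a + b) * (y i * y l * z j * z k + y j * y l * z i * z k + y k * y l * z i * z j) +
      2 * b * (y i * z j * z k * z l + y j * z i * z k * z l + y k * z i * z j * z l) = 0 := by
    linear_combination hQ i l j k + hQ i l k j + hQ j l i k + hQ j l k i + hQ k l i j + hQ k l j i
  have h : (2 : R) * (3 * a * (a ^ 2 - b ^ 2) * (y i * y j * y k * z l)) = 0 := by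
    -- `r₅ - r₃` is 3aA + (a + 2b)C, the second bracket is aC + bD, and `r₇ - 2 * r₁ - 2 * r₃` is
    -- 2(bC + aD).
    linear_combination 2 * (a ^ 2 - b ^ 2) * (r₅ - r₃) -
      (a + 2 * b) * (2 * a * (r₅ + 2 * r₁ - r₂ - r₃) - b * (r₇ - 2 * r₁ - 2 * r₃))
  refine eq_zero_of_algebraMap_mul (K := K) (c := 2) two_ne_zero ?_
  simpa only [map_ofNat] using h

theorem quartic_eq_zero [CharZero K] {α₁ α₂ : K} (hα : α₁ * α₂ * (α₁ + α₂) * (α₁ - α₂) ≠ 0)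
    {y z : ι → R}
    (hP : ∀ i j k, polarCubic (algebraMap K R α₁) (algebraMap K R α₂)
      (y i) (y j) (y k) (z i) (z j) (z k) = 0)
    (hQ : ∀ i j k l, polarCubic (algebraMap K R α₁) (algebraMap K R α₂)
      (y i) (y j) (y k * z l) (z i) (z j) (y k * z l) = 0) (i j k l : ι) :
    y i * y j * y k * z l = 0 ∧ y i * y j * z k * z l = 0 ∧ y i * z j * z k * z l = 0 := by
  have h₁ : α₁ ≠ 0 := by rintro rfl; simp at hα
  have h₂ : α₂ ≠ 0 := by rintro rfl; simp at hα
  have h₃ : α₁ + α₂ ≠ 0 := fun h => by simp [h] at hα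
  have h₄ : α₁ - α₂ ≠ 0 := fun h => by simp [h] at hα
  have hy := yyyz_eq_zero h₁ (by rw [sq_sub_sq]; exact mul_ne_zero h₃ h₄) hP hQ
  -- The hypotheses are invariant under exchanging y with z and α₁ with α₂.
  have hz := yyyz_eq_zero (y := z) (z := y) h₂
    (by rw [sq_sub_sq]; exact mul_ne_zero (by rwa [add_comm]) (by rwa [← neg_sub, neg_ne_zero]))
    (fun i j k => by
      simpa only [polarCubic, mul_assoc, mul_comm, mul_left_comm, add_comm, add_left_comm,
        add_assoc] using hP i j k)
    (fun i j k l => by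
      have := hQ i j l k
      simp only [polarCubic] at this ⊢
      linear_combination this)
  -- Once the terms of types yyyz and yzzz vanish, only the mixed terms of `hQ` survive, with
  -- coefficient α₁ + α₂.
  have hE : ∀ i j k l, y k * z l * (y i * z j + y j * z i) = 0 := fun i j k l => by
    refine eq_zero_of_algebraMap_mul h₃ ?_
    have := hQ i j k l
    simp only [polarCubic] at this
    rw [map_add]
    linear_combination this - algebraMap K R α₁ * hy i j k l - algebraMap K R α₂ * hz i j l k
  refine ⟨hy i j k l, ?_, by linear_combination hz l k j i⟩
  refine eq_zero_of_algebraMap_mul (K := K) (c := 2) two_ne_zero ?_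
  rw [map_ofNat]
  -- With y_i fixed, y_j z_k z_l is symmetric in k, l and antisymmetric in j, k, hence zero.
  linear_combination hE j k i l + hE j l i k - hE k l i j

/-- Products of degree three vanish as soon as the polarized squares vanish. -/
theorem cubic_eq_zero_of_sq [CharZero K] {y z : ι → R}
    (hpol : ∀ i j, y i * z j + y j * z i = 0) (i j k : ι) :
    y i * y j * z k = 0 ∧ y i * z j * z k = 0 := by
  -- Each product is symmetric in one pair of indices and antisymmetric in an overlapping pair, so
  -- twice it vanishes.
  constructor <;> refine eq_zero_of_algebraMap_mul (K := K) (c := 2) two_ne_zero ?_ <;>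
    rw [map_ofNat]
  · linear_combination y i * hpol j k + y j * hpol i k - y k * hpol i j
  · linear_combination z k * hpol i j + z j * hpol i k - z i * hpol j k

/-- Products of degree three vanish as soon as the commutators vanish. -/
theorem cubic_eq_zero_of_comm [CharZero K] {α₁ α₂ : K} (h₃ : α₁ + α₂ ≠ 0) {y z : ι → R}
    (hP : ∀ i j k, polarCubic (algebraMap K R α₁) (algebraMap K R α₂)
      (y i) (y j) (y k) (z i) (z j) (z k) = 0)
    (h : ∀ i j, y i * z j - y j * z i = 0)
    (hsub : ∀ i j k, y i * (y j * z k) - (y j * z k) * z i = 0) (i j k : ι) :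
    y i * y j * z k = 0 ∧ y i * z j * z k = 0 := by
  have hy : ∀ i j k, y i * y j * z k = 0 := fun i j k => by
    refine eq_zero_of_algebraMap_mul (K := K) (c := 3 * (α₁ + α₂))
      (mul_ne_zero three_ne_zero h₃) ?_
    have := hP i j k
    simp only [polarCubic] at this
    rw [map_mul, map_add, map_ofNat]
    set a := algebraMap K R α₁
    set b := algebraMap K R α₂
    -- All six monomials occurring in `hP` coincide, which turns `hP` into 3(α₁ + α₂) times one of
    -- them.
    have e₁ : y i * y k * z j = y i * y j * z k := by linear_combination - y i * h j k
    have e₂ : y j * y k * z i = y i * y j * z k := by linear_combination - y j * h i k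
    have e₃ : y i * z j * z k = y i * y j * z k := by linear_combination - hsub j i k
    have e₄ : y j * z i * z k = y i * y j * z k := by linear_combination - hsub i j k
    have e₅ : y k * z i * z j = y i * y j * z k := by
      linear_combination - hsub i k j - y i * h j k
    rw [e₁, e₂, e₃, e₄, e₅] at this
    linear_combination this
  exact ⟨hy i j k, by linear_combination hy j i k - hsub j i k⟩

/-- Products of degree three vanish as soon as those in the span of the highest weight vectors
do. -/
theorem cubic_eq_zero_of_hwv [CharZero K] {α₁ α₂ : K} (h₂ : α₂ ≠ 0) {y z : ι → R}
    (hP : ∀ i j k, polarCubic (algebraMap K R α₁) (algebraMap K R α₂)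
      (y i) (y j) (y k) (z i) (z j) (z k) = 0)
    (h : ∀ i j k, y i * y j * z k + y i * y k * z j + y j * y k * z i = 0)
    (hy : ∀ i j k, y i * (y j * z k - y k * z j) + y j * (y i * z k - y k * z i) = 0)
    (hz : ∀ i j k, (y i * z k - y k * z i) * z j + (y j * z k - y k * z j) * z i = 0)
    (i j k : ι) :
    y i * y j * z k = 0 ∧ y i * z j * z k = 0 := by
  -- Modulo the polarized y²z, the identity is α₂ times the polarized yz².
  have h' : ∀ i j k, y i * z j * z k + y j * z i * z k + y k * z i * z j = 0 := fun i j k => by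
    refine eq_zero_of_algebraMap_mul h₂ ?_
    have := hP i j k
    simp only [polarCubic] at this
    linear_combination this - algebraMap K R α₁ * h i j k
  constructor <;> refine eq_zero_of_algebraMap_mul (K := K) (c := 3) three_ne_zero ?_ <;>
    rw [map_ofNat]
  · linear_combination h i j k + hy i j k
  · linear_combination h' i j k - hz j k i

end QuarticRelations

/-! ### Endomorphisms of the free bicommutative algebra as substitutions. -/

namespace GAlg

section Endomorphism

variable {K : Type*} [Field K] {d : ℕ}

@[simp] theorem leftPoly_ofPoly (p : YZ K d) (hp) : leftPoly (ofPoly p hp) = p := by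
  simp [leftPoly]

@[simp] theorem rightPoly_ofPoly (p : YZ K d) (hp) : rightPoly (ofPoly p hp) = p := by
  simp [rightPoly]

@[simp] theorem lin_x (i : Fin d) : lin (x i : GAlg K d) = Pi.single i 1 := rfl

@[simp] theorem poly_x (i : Fin d) : poly (x i : GAlg K d) = 0 := rfl

theorem ofPoly_poly {a : GAlg K d} (ha : lin a = 0) : ofPoly (poly a) (poly_mem a) = a := by
  ext1
  · rw [lin_ofPoly, ha]
  · rw [poly_ofPoly]

/-- The substitution `y_i ↦ leftPoly (u i)`, `z_i ↦ rightPoly (u i)`. -/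
noncomputable def subst (u : Fin d → GAlg K d) : YZ K d →ₐ[K] YZ K d :=
  aeval (Sum.elim (fun i => leftPoly (u i)) fun i => rightPoly (u i))

@[simp] theorem subst_yv (u : Fin d → GAlg K d) (i : Fin d) :
    subst u (yv K d i) = leftPoly (u i) := by simp [subst, yv]

@[simp] theorem subst_zv (u : Fin d → GAlg K d) (i : Fin d) :
    subst u (zv K d i) = rightPoly (u i) := by simp [subst, zv]

theorem subst_mem (u : Fin d → GAlg K d) {p : YZ K d} (hp : p ∈ omegaYZ K d) :
    subst u p ∈ omegaYZ K d := by
  have h : (omegaYZ K d).map (subst u) ≤ omegaYZ K d := by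
    rw [omegaYZ, Ideal.map_mul, Ideal.map_span, Ideal.map_span]
    refine Ideal.mul_mono (Ideal.span_le.2 ?_) (Ideal.span_le.2 ?_)
    · rintro _ ⟨_, ⟨i, rfl⟩, rfl⟩
      exact (subst_yv u i).symm ▸ leftPoly_mem (u i)
    · rintro _ ⟨_, ⟨i, rfl⟩, rfl⟩
      exact (subst_zv u i).symm ▸ rightPoly_mem (u i)
  exact h (Ideal.mem_map_of_mem _ hp)

/-- The linear map underlying the endomorphism `x_i ↦ u i`. -/
noncomputable def endoLin (u : Fin d → GAlg K d) : GAlg K d →ₗ[K] GAlg K d where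
  toFun a := Fintype.linearCombination K u (lin a) +
    ofPoly (subst u (poly a)) (subst_mem u (poly_mem a))
  map_add' a b := by
    ext1 <;> simp only [map_add, lin_ofPoly, poly_ofPoly] <;> abel
  map_smul' k a := by
    ext1 <;> simp

/-- Intertwining both `leftPoly` and `rightPoly` with one ring homomorphism is what makes `endoLin`
multiplicative. -/
theorem leftPoly_endoLin (u : Fin d → GAlg K d) (a : GAlg K d) :
    leftPoly (endoLin u a) = subst u (leftPoly a) := by
  simp [endoLin, leftPoly, Fintype.linearCombination_apply, Finset.sum_add_distrib, add_assoc]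

theorem rightPoly_endoLin (u : Fin d → GAlg K d) (a : GAlg K d) :
    rightPoly (endoLin u a) = subst u (rightPoly a) := by
  simp [endoLin, rightPoly, Fintype.linearCombination_apply, Finset.sum_add_distrib, add_assoc]

/-- The endomorphism `x_i ↦ u i`. -/
noncomputable def endo (u : Fin d → GAlg K d) : GAlg K d →ₙₐ[K] GAlg K d where
  toFun := endoLin u
  map_smul' k a := by simp
  map_zero' := map_zero _
  map_add' := map_add _
  map_mul' a b := by
    ext1
    · simp [endoLin]
    · rw [poly_mul, leftPoly_endoLin, rightPoly_endoLin, ← map_mul]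
      simp [endoLin]

theorem endo_x (u : Fin d → GAlg K d) (i : Fin d) : endo u (x i) = u i := by
  change endoLin u (x i) = u i
  ext1 <;> simp [endoLin]

theorem endo_ofPoly (u : Fin d → GAlg K d) (p : YZ K d) (hp) :
    endo u (ofPoly p hp) = ofPoly (subst u p) (subst_mem u hp) := by
  change endoLin u (ofPoly p hp) = _
  ext1 <;> simp [endoLin]

theorem endo_apply_of_lin (u : Fin d → GAlg K d) (a : GAlg K d) (ha : poly a = 0) :
    endo u a = ∑ i, lin a i • u i := by
  change endoLin u a = _
  ext1 <;> simp [endoLin, ha, Fintype.linearCombination_apply]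

end Endomorphism

/-! ### T-ideals as substitution-stable ideals of K[Y, Z]. -/

section PolyIdeal

variable {K : Type*} [Field K] {d : ℕ} {I : Submodule K (GAlg K d)}

/-- The polynomial part of a T-ideal, an ideal of `K[Y, Z]`. -/
def polyIdeal (hI : IsTIdeal K I) : Ideal (YZ K d) where
  carrier := {p | ∃ hp, ofPoly p hp ∈ I}
  zero_mem' := ⟨zero_mem _, I.zero_mem⟩
  add_mem' := by
    rintro p q ⟨hp, hp'⟩ ⟨hq, hq'⟩
    refine ⟨add_mem hp hq, ?_⟩
    convert I.add_mem hp' hq' using 1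
    ext1 <;> simp
  smul_mem' := by
    rintro r p hp
    induction r using MvPolynomial.induction_on generalizing p with
    | C k =>
      obtain ⟨hp, hp'⟩ := hp
      refine ⟨Ideal.mul_mem_left _ _ hp, ?_⟩
      convert I.smul_mem k hp' using 1
      ext1 <;> simp [MvPolynomial.smul_eq_C_mul]
    | add r s hr hs =>
      obtain ⟨h₁, h₁'⟩ := hr hp
      obtain ⟨h₂, h₂'⟩ := hs hp
      refine ⟨Ideal.mul_mem_left _ _ hp.1, ?_⟩
      convert I.add_mem h₁' h₂' using 1
      ext1 <;> simp [add_mul]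
    | mul_X r n h =>
      rw [smul_eq_mul, mul_assoc]
      refine h ?_
      obtain ⟨hp, hp'⟩ := hp
      refine ⟨Ideal.mul_mem_left _ _ hp, ?_⟩
      -- Multiplication by y_i is left multiplication by x_i, and multiplication by z_i is right
      -- multiplication by x_i.
      rcases n with i | i
      · convert hI.mul_mem_left (x i) _ hp' using 1
        ext1 <;> simp [yv]
      · convert hI.mul_mem_right _ (x i) hp' using 1
        ext1 <;> simp [zv, mul_comm]

theorem mem_polyIdeal (hI : IsTIdeal K I) {p : YZ K d} (hp : p ∈ omegaYZ K d) :
    p ∈ polyIdeal hI ↔ ofPoly p hp ∈ I := ⟨fun h => h.2, fun h => ⟨hp, h⟩⟩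

theorem poly_mem_polyIdeal (hI : IsTIdeal K I) {a : GAlg K d} (ha : lin a = 0) :
    poly a ∈ polyIdeal hI ↔ a ∈ I := by
  rw [mem_polyIdeal hI (poly_mem a), ofPoly_poly ha]

theorem subst_mem_polyIdeal (hI : IsTIdeal K I) (u : Fin d → GAlg K d) {p : YZ K d}
    (hp : p ∈ polyIdeal hI) : subst u p ∈ polyIdeal hI := by
  obtain ⟨h, h'⟩ := hp
  refine ⟨subst_mem u h, ?_⟩
  rw [← endo_ofPoly u p h]
  exact hI.map_mem _ _ h'

end PolyIdeal

/-! ### Spanning monomials of the homogeneous components. -/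

section Homogeneous

variable {K : Type*} [Field K] {d : ℕ}

/-- `J` is only a subspace, so that the lemma serves ideals, the span of the y_i z_j in degree 2,
and the zero space in degrees below 2. -/
theorem mem_of_isHomogeneous {J : Submodule K (YZ K d)} {n : ℕ}
    (h : ∀ (m : Fin d ⊕ Fin d →₀ ℕ), m.degree + 2 = n → ∀ i j,
      monomial m 1 * (yv K d i * zv K d j) ∈ J)
    {p : YZ K d} (hp : p ∈ omegaYZ K d) (hn : p.IsHomogeneous n) : p ∈ J := by
  -- Homogeneity does not survive an induction on sums; the claim about the component of degree `n`
  -- does.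
  suffices H : homogeneousComponent n p ∈ J by
    rwa [homogeneousComponent_of_mem hn, if_pos rfl] at H
  clear hn
  rw [omegaYZ, Ideal.span_mul_span'] at hp
  induction hp using Submodule.closure_induction with
  | zero => rw [map_zero]; exact J.zero_mem
  | add p q _ _ hp hq => rw [map_add]; exact J.add_mem hp hq
  | smul_mem r p hp =>
    obtain ⟨_, ⟨i, rfl⟩, _, ⟨j, rfl⟩, rfl⟩ := hp
    have hyz : (yv K d i * zv K d j).IsHomogeneous 2 :=
      (isHomogeneous_X K _).mul (isHomogeneous_X K _)
    simp only [smul_eq_mul]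
    induction r using MvPolynomial.induction_on' with
    | add r s hr hs => rw [add_mul, map_add]; exact J.add_mem hr hs
    | monomial m c =>
      rw [homogeneousComponent_of_mem ((isHomogeneous_monomial c rfl).mul hyz)]
      split_ifs with hn
      · have : monomial m c = c • monomial m (1 : K) := by rw [smul_monomial, smul_eq_mul, mul_one]
        rw [this, smul_mul_assoc]
        exact J.smul_mem c (h m hn.symm i j)
      · exact J.zero_mem

theorem monomial_eq_X_mul {m : Fin d ⊕ Fin d →₀ ℕ} {n : ℕ} (hm : m.degree = n + 1) :
    ∃ a m', m'.degree = n ∧ monomial m (1 : K) = X a * monomial m' 1 := by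
  obtain ⟨a, ha⟩ : ∃ a, m a ≠ 0 := by
    by_contra! h
    have : m = 0 := Finsupp.ext h
    simp [this] at hm
  have hle : Finsupp.single a 1 ≤ m := by
    rw [Finsupp.single_le_iff]; omega
  have hm' : Finsupp.single a 1 + (m - Finsupp.single a 1) = m := add_tsub_cancel_of_le hle
  refine ⟨a, m - Finsupp.single a 1, ?_, ?_⟩
  · have := congrArg Finsupp.degree hm'
    rw [map_add, Finsupp.degree_single, hm] at this
    omega
  · rw [X, monomial_mul, hm', mul_one]

variable {J : Ideal (YZ K d)} {p : YZ K d}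

theorem mem_ideal_of_isHomogeneous_two (h : ∀ i j, yv K d i * zv K d j ∈ J)
    (hp : p ∈ omegaYZ K d) (hn : p.IsHomogeneous 2) : p ∈ J :=
  mem_of_isHomogeneous (J := J.restrictScalars K)
    (fun _ _ i j => J.mul_mem_left _ (h i j)) hp hn

theorem mem_ideal_of_isHomogeneous_three
    (h : ∀ i j k, yv K d i * yv K d j * zv K d k ∈ J ∧ yv K d i * zv K d j * zv K d k ∈ J)
    (hp : p ∈ omegaYZ K d) (hn : p.IsHomogeneous 3) : p ∈ J := by
  refine mem_of_isHomogeneous (J := J.restrictScalars K) (fun m hm i j => ?_) hp hn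
  obtain ⟨a, m', -, h'⟩ := monomial_eq_X_mul (K := K) (n := 0) (m := m) (by omega)
  rw [h', mul_comm (X a), mul_assoc]
  refine J.mul_mem_left _ ?_
  rcases a with k | k
  · simpa only [yv, mul_assoc] using (h k i j).1
  · have := (h i j k).2
    rwa [mul_comm] at this

theorem mem_ideal_of_isHomogeneous_of_four_le {n : ℕ} (hn4 : 4 ≤ n)
    (h : ∀ i j k l, yv K d i * yv K d j * yv K d k * zv K d l ∈ J ∧
      yv K d i * yv K d j * zv K d k * zv K d l ∈ J ∧
      yv K d i * zv K d j * zv K d k * zv K d l ∈ J)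
    (hp : p ∈ omegaYZ K d) (hn : p.IsHomogeneous n) : p ∈ J := by
  refine mem_of_isHomogeneous (J := J.restrictScalars K) (fun m hm i j => ?_) hp hn
  obtain ⟨a, m', hm', h'⟩ := monomial_eq_X_mul (K := K) (n := n - 3) (m := m) (by omega)
  obtain ⟨b, m'', -, h''⟩ := monomial_eq_X_mul (K := K) (n := n - 4) (m := m') (by omega)
  rw [h', h'']
  have key : X a * X b * (yv K d i * zv K d j) ∈ J := by
    rcases a with k | k <;> rcases b with l | l
    · convert (h k l i j).1 using 1; simp only [yv]; ring
    · convert (h k i l j).2.1 using 1; simp only [yv, zv]; ring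
    · convert (h l i k j).2.1 using 1; simp only [yv, zv]; ring
    · convert (h i k l j).2.2 using 1; simp only [yv, zv]; ring
  change _ ∈ J
  convert J.mul_mem_left (monomial m'' 1) key using 1
  ring

theorem exists_eq_sum_of_isHomogeneous_two (hp : p ∈ omegaYZ K d) (hn : p.IsHomogeneous 2) :
    ∃ c : Fin d → Fin d → K, p = ∑ i, ∑ j, c i j • (yv K d i * zv K d j) := by
  have h : p ∈ Submodule.span K (Set.range fun ij : Fin d × Fin d =>
      yv K d ij.1 * zv K d ij.2) := by
    refine mem_of_isHomogeneous (fun m hm i j => ?_) hp hn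
    obtain rfl : m = 0 := by
      rw [← Finsupp.degree_eq_zero_iff]; omega
    exact Submodule.subset_span ⟨(i, j), by simp⟩
  obtain ⟨c, rfl⟩ := (Submodule.mem_span_range_iff_exists_fun K).1 h
  exact ⟨fun i j => c (i, j), Fintype.sum_prod_type _⟩

theorem eq_zero_of_mem_omegaYZ (hp : p ∈ omegaYZ K d) {n : ℕ} (hn : p.IsHomogeneous n)
    (h2 : n < 2) : p = 0 := by
  have : p ∈ (⊥ : Submodule K (YZ K d)) :=
    mem_of_isHomogeneous (fun m hm => absurd hm (by omega)) hp hn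
  simpa using this

end Homogeneous
end GAlg

/-! ### Cubic and quartic consequences in the presence of the identity. -/

namespace GAlg

section Consequences

variable {K : Type*} [Field K] {d : ℕ} {I : Submodule K (GAlg K d)}

theorem map_polarCubic {R S : Type*} [CommRing R] [CommRing S] (f : R →+* S)
    (a b y₁ y₂ y₃ z₁ z₂ z₃ : R) :
    f (polarCubic a b y₁ y₂ y₃ z₁ z₂ z₃) =
      polarCubic (f a) (f b) (f y₁) (f y₂) (f y₃) (f z₁) (f z₂) (f z₃) := by
  simp [polarCubic]

theorem mem_of_C_mul_mem {J : Ideal (YZ K d)} {c : K} (hc : c ≠ 0) {p : YZ K d}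
    (h : C c * p ∈ J) : p ∈ J := by
  have := J.mul_mem_left (C c⁻¹) h
  rwa [← mul_assoc, ← C_mul, inv_mul_cancel₀ hc, C_1, one_mul] at this

theorem homog_three_le (hI : IsTIdeal K I)
    (h : ∀ i j k : Fin d,
      Ideal.Quotient.mk (polyIdeal hI) (yv K d i) * Ideal.Quotient.mk (polyIdeal hI) (yv K d j) *
        Ideal.Quotient.mk (polyIdeal hI) (zv K d k) = 0 ∧
      Ideal.Quotient.mk (polyIdeal hI) (yv K d i) * Ideal.Quotient.mk (polyIdeal hI) (zv K d j) *
        Ideal.Quotient.mk (polyIdeal hI) (zv K d k) = 0) : homog K d 3 ≤ I := by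
  rintro a ⟨h₁, h₂⟩
  rw [← poly_mem_polyIdeal hI (h₁ (by omega))]
  refine mem_ideal_of_isHomogeneous_three (fun i j k => ?_) (poly_mem a) h₂
  simpa only [← map_mul, Ideal.Quotient.eq_zero_iff_mem] using h i j k

/-- The endomorphism data `x_1 ↦ u`, `x_2 ↦ v`. -/
noncomputable def pairSubst (hd : 2 ≤ d) (u v : GAlg K d) (i : Fin d) : GAlg K d :=
  if i = i₁ hd then u else v

theorem pairSubst_one {hd : 2 ≤ d} (u v : GAlg K d) : pairSubst hd u v (i₁ hd) = u := if_pos rfl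

theorem pairSubst_two {hd : 2 ≤ d} (u v : GAlg K d) : pairSubst hd u v (i₂ hd) = v :=
  if_neg (by simp [i₁, i₂])

theorem polarCubic_mem_polyIdeal [CharZero K] (hI : IsTIdeal K I) {hd : 2 ≤ d} {α₁ α₂ : K}
    (hid : ident3 K hd α₁ α₂ ∈ I) (u v w : GAlg K d) :
    polarCubic (C α₁) (C α₂) (leftPoly u) (leftPoly v) (leftPoly w)
      (rightPoly u) (rightPoly v) (rightPoly w) ∈ polyIdeal hI := by
  have F : ∀ u : GAlg K d, C α₁ * (leftPoly u * (leftPoly u * rightPoly u)) +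
      C α₂ * (leftPoly u * rightPoly u * rightPoly u) ∈ polyIdeal hI := fun u => by
    have h := hI.map_mem (endo fun _ => u) _ hid
    rw [← poly_mem_polyIdeal hI (by simp [ident3])] at h
    simpa [ident3, endo_x, MvPolynomial.smul_eq_C_mul] using h
  refine mem_of_C_mul_mem (c := 2) two_ne_zero ?_
  -- Inclusion–exclusion polarizes the cubic form; the square in y²z and in yz² makes the result
  -- twice `polarCubic`.
  have h := add_mem (sub_mem (sub_mem (sub_mem (F (u + v + w)) (F (u + v))) (F (u + w)))
    (F (v + w))) (add_mem (add_mem (F u) (F v)) (F w))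
  convert h using 1
  simp only [polarCubic, map_add, map_ofNat]
  ring

variable [CharZero K] {hd : 2 ≤ d} {α₁ α₂ : K}

theorem quotient_polarCubic_eq_zero (hI : IsTIdeal K I) (hid : ident3 K hd α₁ α₂ ∈ I)
    (u v w : GAlg K d) :
    polarCubic (algebraMap K (YZ K d ⧸ polyIdeal hI) α₁)
      (algebraMap K (YZ K d ⧸ polyIdeal hI) α₂)
      (Ideal.Quotient.mk (polyIdeal hI) (leftPoly u))
      (Ideal.Quotient.mk (polyIdeal hI) (leftPoly v))
      (Ideal.Quotient.mk (polyIdeal hI) (leftPoly w))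
      (Ideal.Quotient.mk (polyIdeal hI) (rightPoly u))
      (Ideal.Quotient.mk (polyIdeal hI) (rightPoly v))
      (Ideal.Quotient.mk (polyIdeal hI) (rightPoly w)) = 0 := by
  have := polarCubic_mem_polyIdeal hI hid u v w
  rw [← Ideal.Quotient.eq_zero_iff_mem, map_polarCubic] at this
  exact this

theorem quotient_polarCubic_x_eq_zero (hI : IsTIdeal K I) (hid : ident3 K hd α₁ α₂ ∈ I)
    (i j k : Fin d) :
    polarCubic (algebraMap K (YZ K d ⧸ polyIdeal hI) α₁)
      (algebraMap K (YZ K d ⧸ polyIdeal hI) α₂)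
      (Ideal.Quotient.mk (polyIdeal hI) (yv K d i)) (Ideal.Quotient.mk (polyIdeal hI) (yv K d j))
      (Ideal.Quotient.mk (polyIdeal hI) (yv K d k)) (Ideal.Quotient.mk (polyIdeal hI) (zv K d i))
      (Ideal.Quotient.mk (polyIdeal hI) (zv K d j))
      (Ideal.Quotient.mk (polyIdeal hI) (zv K d k)) = 0 := by
  have := quotient_polarCubic_eq_zero hI hid (x i) (x j) (x k)
  rwa [leftPoly_x, leftPoly_x, leftPoly_x, rightPoly_x, rightPoly_x, rightPoly_x] at this

theorem homog_le_of_four_le (hI : IsTIdeal K I) (hα : α₁ * α₂ * (α₁ + α₂) * (α₁ - α₂) ≠ 0)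
    (hid : ident3 K hd α₁ α₂ ∈ I) {n : ℕ} (hn : 4 ≤ n) : homog K d n ≤ I := by
  rintro a ⟨h₁, h₂⟩
  rw [← poly_mem_polyIdeal hI (h₁ (by omega))]
  refine mem_ideal_of_isHomogeneous_of_four_le hn (fun i j k l => ?_) (poly_mem a) h₂
  have key := quartic_eq_zero (R := YZ K d ⧸ polyIdeal hI) hα
    (y := fun i => Ideal.Quotient.mk (polyIdeal hI) (yv K d i))
    (z := fun i => Ideal.Quotient.mk (polyIdeal hI) (zv K d i))
    (quotient_polarCubic_x_eq_zero hI hid)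
    (fun i j k l => by
      have := quotient_polarCubic_eq_zero hI hid (x i) (x j) (x k * x l)
      rwa [leftPoly_mul, rightPoly_mul, leftPoly_x, leftPoly_x, leftPoly_x, rightPoly_x,
        rightPoly_x, rightPoly_x, map_mul] at this)
    i j k l
  simpa only [← map_mul, Ideal.Quotient.eq_zero_iff_mem] using key

theorem homog_three_le_of_sq (hI : IsTIdeal K I) (h : ∀ i, yv K d i * zv K d i ∈ polyIdeal hI) :
    homog K d 3 ≤ I := by
  have h' : ∀ i j, yv K d i * zv K d j + yv K d j * zv K d i ∈ polyIdeal hI := fun i j => by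
    have := subst_mem_polyIdeal hI (fun _ => x i + x j) (h i)
    convert sub_mem (sub_mem this (h i)) (h j) using 1
    simp
    ring
  refine homog_three_le hI fun i j k => cubic_eq_zero_of_sq (K := K)
    (y := fun i => Ideal.Quotient.mk (polyIdeal hI) (yv K d i))
    (z := fun i => Ideal.Quotient.mk (polyIdeal hI) (zv K d i)) (fun i j => ?_) i j k
  simpa using Ideal.Quotient.eq_zero_iff_mem.2 (h' i j)

/-- The commutator is needed for all `u` and `v`, since the argument also uses the commutator of x_i
with x_j x_k. -/
theorem homog_three_le_of_comm (hI : IsTIdeal K I) (h₃ : α₁ + α₂ ≠ 0)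
    (hid : ident3 K hd α₁ α₂ ∈ I)
    (h : ∀ u v : GAlg K d, leftPoly u * rightPoly v - leftPoly v * rightPoly u ∈ polyIdeal hI) :
    homog K d 3 ≤ I := by
  refine homog_three_le hI fun i j k => cubic_eq_zero_of_comm h₃
    (y := fun i => Ideal.Quotient.mk (polyIdeal hI) (yv K d i))
    (z := fun i => Ideal.Quotient.mk (polyIdeal hI) (zv K d i))
    (quotient_polarCubic_x_eq_zero hI hid) (fun i j => ?_) (fun i j k => ?_) i j k
  · have := h (x i) (x j)
    rw [leftPoly_x, leftPoly_x, rightPoly_x, rightPoly_x] at this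
    simpa only [← map_mul, ← map_sub, Ideal.Quotient.eq_zero_iff_mem] using this
  · have := h (x i) (x j * x k)
    rw [leftPoly_mul, rightPoly_mul, leftPoly_x, leftPoly_x, rightPoly_x, rightPoly_x] at this
    simpa only [← map_mul, ← map_sub, Ideal.Quotient.eq_zero_iff_mem] using this

theorem homog_three_le_of_hwv (hI : IsTIdeal K I) (h₂ : α₂ ≠ 0) (hid : ident3 K hd α₁ α₂ ∈ I)
    (h30 : hwvPoly K hd 3 0 2 ∈ polyIdeal hI) (h211 : hwvPoly K hd 2 1 1 ∈ polyIdeal hI)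
    (h210 : hwvPoly K hd 2 1 0 ∈ polyIdeal hI) : homog K d 3 ≤ I := by
  have e30 : ∀ u : GAlg K d, leftPoly u ^ 2 * rightPoly u ∈ polyIdeal hI := fun u => by
    simpa [hwvPoly] using subst_mem_polyIdeal hI (fun _ => u) h30
  have e211 : ∀ u v : GAlg K d,
      leftPoly u * (leftPoly u * rightPoly v - leftPoly v * rightPoly u) ∈ polyIdeal hI :=
    fun u v => by
      simpa [hwvPoly, pairSubst_one, pairSubst_two] using
        subst_mem_polyIdeal hI (pairSubst hd u v) h211
  have e210 : ∀ u v : GAlg K d,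
      (leftPoly u * rightPoly v - leftPoly v * rightPoly u) * rightPoly u ∈ polyIdeal hI :=
    fun u v => by
      simpa [hwvPoly, pairSubst_one, pairSubst_two] using
        subst_mem_polyIdeal hI (pairSubst hd u v) h210
  refine homog_three_le hI fun i j k => cubic_eq_zero_of_hwv h₂
    (y := fun i => Ideal.Quotient.mk (polyIdeal hI) (yv K d i))
    (z := fun i => Ideal.Quotient.mk (polyIdeal hI) (zv K d i))
    (quotient_polarCubic_x_eq_zero hI hid) (fun i j k => ?_) (fun i j k => ?_) (fun i j k => ?_)
    i j k <;>
  simp only [← map_mul, ← map_add, ← map_sub, Ideal.Quotient.eq_zero_iff_mem]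
  · refine mem_of_C_mul_mem (c := 2) two_ne_zero ?_
    convert add_mem (sub_mem (sub_mem (sub_mem (e30 (x i + x j + x k)) (e30 (x i + x j)))
      (e30 (x i + x k))) (e30 (x j + x k))) (add_mem (add_mem (e30 (x i)) (e30 (x j)))
      (e30 (x k))) using 1
    simp only [map_add, leftPoly_x, rightPoly_x, map_ofNat]
    ring
  · convert sub_mem (sub_mem (e211 (x i + x j) (x k)) (e211 (x i) (x k))) (e211 (x j) (x k)) using 1
    simp only [map_add, leftPoly_x, rightPoly_x]
    ring
  · convert sub_mem (sub_mem (e210 (x i + x j) (x k)) (e210 (x i) (x k))) (e210 (x j) (x k)) using 1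
    simp only [map_add, leftPoly_x, rightPoly_x]
    ring

/-- A nonzero quadratic element of a T-ideal implies everything in degree three. -/
theorem homog_three_le_of_homog_two (hI : IsTIdeal K I) (h₃ : α₁ + α₂ ≠ 0)
    (hid : ident3 K hd α₁ α₂ ∈ I) {a : GAlg K d} (ha : a ∈ homog K d 2) (ha0 : a ≠ 0) (haI : a ∈ I) : homog K d 3 ≤ I := by
  obtain ⟨hl, hh⟩ := ha
  replace hl := hl (by norm_num)
  rw [← poly_mem_polyIdeal hI hl] at haI
  obtain ⟨c, hc⟩ := exists_eq_sum_of_isHomogeneous_two (poly_mem a) hh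
  have hsum : ∀ u : Fin d → GAlg K d,
      ∑ i, ∑ j, c i j • (leftPoly (u i) * rightPoly (u j)) ∈ polyIdeal hI := fun u => by
    have := subst_mem_polyIdeal hI u haI
    rw [hc] at this
    simpa only [map_sum, map_smul, map_mul, subst_yv, subst_zv] using this
  by_cases hdiag : ∃ i, c i i ≠ 0
  · obtain ⟨i, hi⟩ := hdiag
    refine homog_three_le_of_sq hI fun k => mem_of_C_mul_mem hi ?_
    -- Sending x_i to x_k and every other generator to 0 isolates the diagonal coefficient.
    convert hsum (Pi.single i (x k)) using 1
    rw [Finset.sum_eq_single i, Finset.sum_eq_single i] <;>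
      simp +contextual [MvPolynomial.smul_eq_C_mul]
  · push Not at hdiag
    obtain ⟨i, j, hij⟩ : ∃ i j, c i j ≠ 0 := by
      by_contra! h
      refine ha0 (GAlg.ext (by rw [hl, map_zero]) ?_)
      rw [hc, map_zero]
      simp [h]
    have hne : i ≠ j := fun h => hij (h ▸ hdiag i)
    have key : ∀ u v : GAlg K d, C (c i j) * (leftPoly u * rightPoly v) +
        C (c j i) * (leftPoly v * rightPoly u) ∈ polyIdeal hI := fun u v => by
      convert hsum (Pi.single i u + Pi.single j v) using 1
      rw [Fintype.sum_eq_add i j hne, Fintype.sum_eq_add i j hne, Fintype.sum_eq_add i j hne]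
      · simp [hdiag, hne, hne.symm, MvPolynomial.smul_eq_C_mul]
      all_goals
        rintro k ⟨hki, hkj⟩
        simp [hki, hkj]
    -- If the two coefficients are opposite, `key` is a multiple of the commutator; otherwise u = v
    -- = x_k gives a nonzero multiple of the square.
    by_cases hs : c i j + c j i = 0
    · refine homog_three_le_of_comm hI h₃ hid fun u v => mem_of_C_mul_mem hij ?_
      convert key u v using 1
      rw [eq_neg_of_add_eq_zero_right hs, C_neg]
      ring
    · refine homog_three_le_of_sq hI fun k => mem_of_C_mul_mem hs ?_
      convert key (x k) (x k) using 1
      simp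
      ring

end Consequences
end GAlg

/-! ### Pulling T-ideals back from the factor algebra. -/

section Descent

variable {K : Type*} [Field K] {A : Type*} [NonUnitalNonAssocRing A] [Module K A] {S : Set A}

/-- The endomorphism of the factor algebra induced by an endomorphism of the algebra. -/
def FactorAlg.descend (S : Set A) (φ : A →ₙₐ[K] A) : FactorAlg K S →ₙₐ[K] FactorAlg K S where
  toFun := (tIdeal K S).mapQ (tIdeal K S) (φ : A →ₗ[K] A)
    fun a ha => (isTIdeal_tIdeal K S).map_mem φ a ha
  map_smul' k a := map_smul (Submodule.mapQ _ _ _ _) k a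
  map_zero' := map_zero (Submodule.mapQ _ _ _ _)
  map_add' a b := map_add (Submodule.mapQ _ _ _ _) a b
  map_mul' a b := by
    obtain ⟨a, rfl⟩ := FactorAlg.mk_surjective K S a
    obtain ⟨b, rfl⟩ := FactorAlg.mk_surjective K S b
    exact congrArg (FactorAlg.mk K S) (map_mul φ a b)

/-- Every endomorphism of `A` preserves the T-ideal generated by `S`, so it induces one of the
factor algebra, under which `I` is stable. -/
theorem IsTIdeal.comap_mk {I : Submodule K (FactorAlg K S)} (hI : IsTIdeal K I) :
    IsTIdeal K (I.comap (FactorAlg.mk K S)) where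
  mul_mem_left a b hb := hI.mul_mem_left (FactorAlg.mk K S a) (FactorAlg.mk K S b) hb
  mul_mem_right a b ha := hI.mul_mem_right (FactorAlg.mk K S a) (FactorAlg.mk K S b) ha
  map_mem φ _ ha := hI.map_mem (FactorAlg.descend S φ) _ ha

theorem subset_comap_mk (I : Submodule K (FactorAlg K S)) :
    S ⊆ I.comap (FactorAlg.mk K S) := fun s hs => by
  have : FactorAlg.mk K S s = 0 :=
    (Submodule.Quotient.mk_eq_zero _).2 (subset_tIdeal K S hs)
  simp [this]

theorem tIdeal_le {T : Set A} {I : Submodule K A} (hI : IsTIdeal K I) (h : T ⊆ I) :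
    tIdeal K T ≤ I := sInf_le ⟨hI, h⟩

end Descent

/-! ### Components of degree at most two. -/

namespace GAlg

variable {K : Type*} [Field K] {d : ℕ}

theorem eq_sum_x {a : GAlg K d} (ha : poly a = 0) : a = ∑ i, lin a i • x i := by
  ext1
  · ext j
    simp [Pi.single_apply]
  · simp [ha]

theorem poly_eq_zero {n : ℕ} (hn : n < 2) {a : GAlg K d} (ha : a ∈ homog K d n) : poly a = 0 :=
  eq_zero_of_mem_omegaYZ (poly_mem a) ha.2 hn

theorem homog_zero : homog K d 0 = ⊥ := by
  rw [eq_bot_iff]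
  intro a ha
  exact GAlg.ext (by rw [ha.1 (by norm_num), map_zero]) (by rw [poly_eq_zero (by norm_num) ha,
    map_zero])

theorem hwvPoly_isHomogeneous (hd : 2 ≤ d) {l₁ l₂ j n : ℕ}
    (hn : j + 2 * l₂ + (l₁ - l₂ - j) = n) : (hwvPoly K hd l₁ l₂ j).IsHomogeneous n := by
  rw [← hn, hwvPoly]
  have hyz : ∀ i k, (yv K d i * zv K d k).IsHomogeneous 2 := fun i k =>
    (isHomogeneous_X K _).mul (isHomogeneous_X K _)
  have h₁ := (isHomogeneous_X K (Sum.inl (i₁ hd) : Fin d ⊕ Fin d)).pow j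
  have h₂ := ((hyz (i₁ hd) (i₂ hd)).sub (hyz (i₂ hd) (i₁ hd))).pow l₂
  have h₃ := (isHomogeneous_X K (Sum.inr (i₁ hd) : Fin d ⊕ Fin d)).pow (l₁ - l₂ - j)
  simpa only [one_mul, yv, zv] using (h₁.mul h₂).mul h₃

theorem hwv_mem_homog (hd : 2 ≤ d) {l₁ l₂ j n : ℕ} (h)
    (hn : j + 2 * l₂ + (l₁ - l₂ - j) = n) : hwv K hd l₁ l₂ j h ∈ homog K d n :=
  ⟨fun _ => lin_ofPoly _ _, by rw [hwv, poly_ofPoly]; exact hwvPoly_isHomogeneous hd hn⟩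

section TIdeals

variable {I : Submodule K (GAlg K d)}

theorem homog_two_le_of_yz (hI : IsTIdeal K I)
    (h : ∀ i j, yv K d i * zv K d j ∈ polyIdeal hI) : homog K d 2 ≤ I := by
  rintro a ⟨h₁, h₂⟩
  rw [← poly_mem_polyIdeal hI (h₁ (by norm_num))]
  exact mem_ideal_of_isHomogeneous_two h (poly_mem a) h₂

theorem homog_two_le_of_x (hI : IsTIdeal K I) (h : ∀ i, x i ∈ I) : homog K d 2 ≤ I :=
  homog_two_le_of_yz hI fun i j => by
    simpa using (poly_mem_polyIdeal hI (lin_mul _ _)).2 (hI.mul_mem_left (x i) (x j) (h j))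

theorem x_mem_of_homog_one (hI : IsTIdeal K I) {a : GAlg K d} (ha : a ∈ homog K d 1)
    (ha0 : a ≠ 0) (haI : a ∈ I) (k : Fin d) : x k ∈ I := by
  have hp := poly_eq_zero (by norm_num) ha
  obtain ⟨i, hi⟩ : ∃ i, lin a i ≠ 0 := by
    by_contra! h
    exact ha0 (GAlg.ext (by rw [map_zero]; exact funext h) (by rw [hp, map_zero]))
  have := hI.map_mem (endo (Pi.single i (x k))) a haI
  rw [endo_apply_of_lin _ _ hp, Finset.sum_eq_single i (by simp +contextual) (by simp),
    Pi.single_eq_same] at this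
  exact (I.smul_mem_iff hi).1 this

theorem homog_two_le_of_hwv [CharZero K] (hI : IsTIdeal K I) {hd : 2 ≤ d}
    (h20 : hwvPoly K hd 2 0 1 ∈ polyIdeal hI) (h11 : hwvPoly K hd 1 1 0 ∈ polyIdeal hI) :
    homog K d 2 ≤ I := by
  have e20 : ∀ u : GAlg K d, leftPoly u * rightPoly u ∈ polyIdeal hI := fun u => by
    simpa [hwvPoly] using subst_mem_polyIdeal hI (fun _ => u) h20
  have e11 : ∀ u v : GAlg K d,
      leftPoly u * rightPoly v - leftPoly v * rightPoly u ∈ polyIdeal hI := fun u v => by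
    simpa [hwvPoly, pairSubst_one, pairSubst_two] using
      subst_mem_polyIdeal hI (pairSubst hd u v) h11
  refine homog_two_le_of_yz hI fun i j => mem_of_C_mul_mem (c := 2) two_ne_zero ?_
  -- Twice y_i z_j is the commutator plus the polarized square.
  convert add_mem (e11 (x i) (x j))
    (sub_mem (sub_mem (e20 (x i + x j)) (e20 (x i))) (e20 (x j))) using 1
  simp only [map_add, leftPoly_x, rightPoly_x, map_ofNat]
  ring

/-- The components of degrees one and two can be separated by a rescaling. -/
theorem mem_of_add_mem [CharZero K] (hI : IsTIdeal K I) {a b : GAlg K d} (ha : a ∈ homog K d 2)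
    (hb : b ∈ homog K d 1) (h : a + b ∈ I) : a ∈ I := by
  have hb' : endo (fun i => (2 : K) • x i) b = (2 : K) • b := by
    have hp := poly_eq_zero (by norm_num) hb
    rw [endo_apply_of_lin _ _ hp]
    conv_rhs => rw [eq_sum_x hp]
    rw [Finset.smul_sum]
    exact Finset.sum_congr rfl fun i _ => smul_comm _ _ _
  have ha' : endo (fun i => (2 : K) • x i) a = (4 : K) • a := by
    have hl := ha.1 (by norm_num)
    obtain ⟨c, hc⟩ := exists_eq_sum_of_isHomogeneous_two (poly_mem a) ha.2
    rw [← ofPoly_poly hl, endo_ofPoly]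
    ext1
    · simp
    · rw [map_smul, poly_ofPoly, poly_ofPoly, hc]
      simp only [map_sum, map_smul, map_mul, subst_yv, subst_zv, leftPoly_x, rightPoly_x,
        Finset.smul_sum, smul_mul_assoc, mul_smul_comm]
      refine Finset.sum_congr rfl fun i _ => Finset.sum_congr rfl fun j _ => ?_
      module
  -- Doubling the generators maps a + b to 4a + 2b; subtracting 2(a + b) leaves 2a.
  have h₁ := hI.map_mem (endo fun i => (2 : K) • x i) _ h
  rw [map_add, ha', hb'] at h₁
  have h₂ : (2 : K) • a ∈ I := by
    convert I.sub_mem h₁ (I.smul_mem 2 h) using 1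
    module
  exact (I.smul_mem_iff two_ne_zero).1 h₂

end TIdeals

end GAlg

/-! ### The statements in the factor algebra. -/

namespace GU

variable {K : Type*} [Field K] {d : ℕ} {hd : 2 ≤ d} {α₁ α₂ : K}

theorem homog_le_of_comap {n : ℕ} {I : Submodule K (GU K hd α₁ α₂)}
    (h : GAlg.homog K d n ≤ I.comap (mk hd α₁ α₂)) : homog hd α₁ α₂ n ≤ I :=
  Submodule.map_le_iff_le_comap.2 h

theorem ident3_mem_comap (I : Submodule K (GU K hd α₁ α₂)) :
    GAlg.ident3 K hd α₁ α₂ ∈ I.comap (mk hd α₁ α₂) := subset_comap_mk I rfl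

theorem w_mem_homog {l₁ l₂ j n : ℕ} (h) (hn : j + 2 * l₂ + (l₁ - l₂ - j) = n) :
    w hd α₁ α₂ l₁ l₂ j h ∈ homog hd α₁ α₂ n :=
  Submodule.mem_map_of_mem (GAlg.hwv_mem_homog hd h hn)

theorem hwvPoly_mem_polyIdeal {l₁ l₂ j : ℕ} (h) {I : Submodule K (GU K hd α₁ α₂)}
    (hI : IsTIdeal K (I.comap (mk hd α₁ α₂))) (hw : w hd α₁ α₂ l₁ l₂ j h ∈ I) :
    GAlg.hwvPoly K hd l₁ l₂ j ∈ GAlg.polyIdeal hI :=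
  (GAlg.mem_polyIdeal hI (GAlg.hwvPoly_mem K hd h)).2 hw

/-- Since `f` generates the whole component of degree `n`, its consequences there are that
component; it remains only that `T` lies in the component and generates it. -/
theorem equivalent_consequences {f : GU K hd α₁ α₂} {n : ℕ} {T : Set (GU K hd α₁ α₂)}
    (hf : homog hd α₁ α₂ n ≤ tIdeal K {f}) (hT : T ⊆ homog hd α₁ α₂ n)
    (hTn : homog hd α₁ α₂ n ≤ tIdeal K T) :
    Equivalent (consequences f n : Set (GU K hd α₁ α₂)) T := by
  have : consequences f n = homog hd α₁ α₂ n := inf_eq_right.2 hf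
  rw [this]
  exact le_antisymm (tIdeal_le (isTIdeal_tIdeal K T) hTn)
    (tIdeal_le (isTIdeal_tIdeal K _) (hT.trans (subset_tIdeal K _)))

theorem homog_eq_bot [CharZero K] (hα : α₁ * α₂ * (α₁ + α₂) * (α₁ - α₂) ≠ 0) {n : ℕ}
    (hn : 4 ≤ n) : homog hd α₁ α₂ n = ⊥ := by
  have hbot : IsTIdeal K (⊥ : Submodule K (GU K hd α₁ α₂)) :=
    ⟨fun a b hb => by simp [(Submodule.mem_bot K).1 hb],
      fun a b ha => by simp [(Submodule.mem_bot K).1 ha],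
      fun φ a ha => by simp [(Submodule.mem_bot K).1 ha]⟩
  exact eq_bot_iff.2 (homog_le_of_comap
    (GAlg.homog_le_of_four_le hbot.comap_mk hα (ident3_mem_comap ⊥) hn))

theorem homog_le_of_hasDegree [CharZero K] (h₃ : α₁ + α₂ ≠ 0) {n : ℕ} (hn : n = 1 ∨ n = 2)
    {f : GU K hd α₁ α₂} (hf : HasDegree hd α₁ α₂ n f) :
    homog hd α₁ α₂ (n + 1) ≤ tIdeal K {f} := by
  obtain ⟨_, ⟨a, ha, rfl⟩, ha0, h, hh, rfl⟩ := hf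
  have hzero : homog hd α₁ α₂ 0 = ⊥ := by rw [homog, GAlg.homog_zero, Submodule.map_bot]
  replace ha0 : a ≠ 0 := by rintro rfl; exact ha0 (map_zero _)
  set f := mk hd α₁ α₂ a + h with hfdef
  have hI : IsTIdeal K ((tIdeal K {f}).comap (mk hd α₁ α₂)) := (isTIdeal_tIdeal K {f}).comap_mk
  have hfI : f ∈ tIdeal K {f} := subset_tIdeal K _ rfl
  refine homog_le_of_comap ?_
  rcases hn with rfl | rfl
  -- There is nothing in degree 0, so `f` is homogeneous when n = 1 and has only a linear tail when
  -- n = 2.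
  · have : ⨆ m ∈ Set.Iio 1, homog hd α₁ α₂ m ≤ ⊥ := iSup₂_le fun m hm => by
      obtain rfl : m = 0 := by simpa using hm
      exact hzero.le
    have h0 : h = 0 := by simpa using this hh
    have haf : mk hd α₁ α₂ a = f := by rw [hfdef, h0, add_zero]
    exact GAlg.homog_two_le_of_x hI
      (GAlg.x_mem_of_homog_one hI ha ha0 (haf.symm ▸ hfI : mk hd α₁ α₂ a ∈ tIdeal K {f}))
  · have : ⨆ m ∈ Set.Iio 2, homog hd α₁ α₂ m ≤ homog hd α₁ α₂ 1 := iSup₂_le fun m hm => by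
      obtain rfl | rfl : m = 0 ∨ m = 1 := by
        have : m < 2 := hm
        omega
      · rw [hzero]; exact bot_le
      · exact le_rfl
    obtain ⟨b, hb, rfl⟩ := this hh
    refine GAlg.homog_three_le_of_homog_two hI h₃ (ident3_mem_comap _) ha ha0
      (GAlg.mem_of_add_mem hI ha hb ?_)
    rw [Submodule.mem_comap, map_add]
    exact hfI

theorem homog_two_le_tIdeal [CharZero K] :
    homog hd α₁ α₂ 2 ≤ tIdeal K {w hd α₁ α₂ 2 0 1 (by norm_num),
      w hd α₁ α₂ 1 1 0 (by norm_num)} := by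
  set T : Set (GU K hd α₁ α₂) := {w hd α₁ α₂ 2 0 1 (by norm_num), w hd α₁ α₂ 1 1 0 (by norm_num)}
  have hI : IsTIdeal K ((tIdeal K T).comap (mk hd α₁ α₂)) := (isTIdeal_tIdeal K T).comap_mk
  exact homog_le_of_comap (GAlg.homog_two_le_of_hwv hI (hd := hd)
    (hwvPoly_mem_polyIdeal (by norm_num) hI (subset_tIdeal K T (by simp [T])))
    (hwvPoly_mem_polyIdeal (by norm_num) hI (subset_tIdeal K T (by simp [T]))))

theorem homog_three_le_tIdeal [CharZero K] (h₂ : α₂ ≠ 0) :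
    homog hd α₁ α₂ 3 ≤ tIdeal K {w hd α₁ α₂ 3 0 2 (by norm_num),
      w hd α₁ α₂ 2 1 1 (by norm_num), w hd α₁ α₂ 2 1 0 (by norm_num)} := by
  set T : Set (GU K hd α₁ α₂) :=
    {w hd α₁ α₂ 3 0 2 (by norm_num), w hd α₁ α₂ 2 1 1 (by norm_num), w hd α₁ α₂ 2 1 0 (by norm_num)}
  have hI : IsTIdeal K ((tIdeal K T).comap (mk hd α₁ α₂)) := (isTIdeal_tIdeal K T).comap_mk
  exact homog_le_of_comap (GAlg.homog_three_le_of_hwv hI h₂ (ident3_mem_comap _)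
    (hwvPoly_mem_polyIdeal (by norm_num) hI (subset_tIdeal K T (by simp [T])))
    (hwvPoly_mem_polyIdeal (by norm_num) hI (subset_tIdeal K T (by simp [T])))
    (hwvPoly_mem_polyIdeal (by norm_num) hI (subset_tIdeal K T (by simp [T]))))

theorem homog_two_le_tIdeal_w1 : homog hd α₁ α₂ 2 ≤ tIdeal K {w1 hd α₁ α₂} := by
  have hI : IsTIdeal K ((tIdeal K {w1 hd α₁ α₂}).comap (mk hd α₁ α₂)) :=
    (isTIdeal_tIdeal K {w1 hd α₁ α₂}).comap_mk
  refine homog_le_of_comap (GAlg.homog_two_le_of_x hI fun i => ?_)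
  have h : GAlg.x (GAlg.i₁ hd) ∈ (tIdeal K {w1 hd α₁ α₂}).comap (mk hd α₁ α₂) :=
    subset_tIdeal K {w1 hd α₁ α₂} rfl
  simpa only [GAlg.endo_x] using hI.map_mem (GAlg.endo fun _ => GAlg.x i) _ h

theorem homog_three_le_tIdeal_w20 [CharZero K] :
    homog hd α₁ α₂ 3 ≤ tIdeal K {w hd α₁ α₂ 2 0 1 (by norm_num)} := by
  have hI : IsTIdeal K ((tIdeal K {w hd α₁ α₂ 2 0 1 (by norm_num)}).comap (mk hd α₁ α₂)) :=
    (isTIdeal_tIdeal K {w hd α₁ α₂ 2 0 1 (by norm_num)}).comap_mk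
  refine homog_le_of_comap (GAlg.homog_three_le_of_sq hI fun i => ?_)
  simpa [GAlg.hwvPoly] using GAlg.subst_mem_polyIdeal hI (fun _ => GAlg.x i)
    (hwvPoly_mem_polyIdeal (by norm_num) hI (subset_tIdeal K _ rfl))

theorem homog_three_le_tIdeal_w11 [CharZero K] (h₃ : α₁ + α₂ ≠ 0) :
    homog hd α₁ α₂ 3 ≤ tIdeal K {w hd α₁ α₂ 1 1 0 (by norm_num)} := by
  have hI : IsTIdeal K ((tIdeal K {w hd α₁ α₂ 1 1 0 (by norm_num)}).comap (mk hd α₁ α₂)) :=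
    (isTIdeal_tIdeal K {w hd α₁ α₂ 1 1 0 (by norm_num)}).comap_mk
  refine homog_le_of_comap (GAlg.homog_three_le_of_comm hI h₃ (ident3_mem_comap _) fun u v => ?_)
  simpa [GAlg.hwvPoly, GAlg.pairSubst_one, GAlg.pairSubst_two] using
    GAlg.subst_mem_polyIdeal hI (GAlg.pairSubst hd u v)
      (hwvPoly_mem_polyIdeal (by norm_num) hI (subset_tIdeal K _ rfl))

end GU

theorem mainTheorem6 {K : Type*} [Field K] [CharZero K] {d : ℕ} (hd : 2 ≤ d) (α₁ α₂ : K)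
    (hα : α₁ * α₂ * (α₁ + α₂) * (α₁ - α₂) ≠ 0) :
    -- there are no nonzero polynomials of degree at least 4
    (∀ n : ℕ, 4 ≤ n → GU.homog hd α₁ α₂ n = ⊥) ∧
    -- (i)
    GU.Equivalent (GU.consequences (GU.w1 hd α₁ α₂) 2 : Set (GU K hd α₁ α₂))
      {GU.w hd α₁ α₂ 2 0 1 (by norm_num), GU.w hd α₁ α₂ 1 1 0 (by norm_num)} ∧
    -- (ii)
    GU.Equivalent
      (GU.consequences (GU.w hd α₁ α₂ 2 0 1 (by norm_num)) 3 : Set (GU K hd α₁ α₂))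
      {GU.w hd α₁ α₂ 3 0 2 (by norm_num), GU.w hd α₁ α₂ 2 1 1 (by norm_num),
        GU.w hd α₁ α₂ 2 1 0 (by norm_num)} ∧
    -- (iii)
    GU.Equivalent
      (GU.consequences (GU.w hd α₁ α₂ 1 1 0 (by norm_num)) 3 : Set (GU K hd α₁ α₂))
      {GU.w hd α₁ α₂ 3 0 2 (by norm_num), GU.w hd α₁ α₂ 2 1 1 (by norm_num),
        GU.w hd α₁ α₂ 2 1 0 (by norm_num)} ∧
    -- an identity of degree 1 or 2 implies all polynomials of the next degree
    (∀ n : ℕ, n = 1 ∨ n = 2 → ∀ f : GU K hd α₁ α₂, GU.HasDegree hd α₁ α₂ n f →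
      GU.homog hd α₁ α₂ (n + 1) ≤ tIdeal K {f}) ∧
    -- (iv)
    GU.consequences (GU.w hd α₁ α₂ 3 0 2 (by norm_num)) 4 = ⊥ ∧
    (∀ β₁ β₂ : K, (β₁, β₂) ≠ (0, 0) →
      GU.consequences (β₁ • GU.w hd α₁ α₂ 2 1 1 (by norm_num) +
        β₂ • GU.w hd α₁ α₂ 2 1 0 (by norm_num)) 4 = ⊥) := by
  have h₂ : α₂ ≠ 0 := by rintro rfl; simp at hα
  have h₃ : α₁ + α₂ ≠ 0 := fun h => by simp [h] at hα
  have h30 : ({GU.w hd α₁ α₂ 3 0 2 (by norm_num), GU.w hd α₁ α₂ 2 1 1 (by norm_num),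
      GU.w hd α₁ α₂ 2 1 0 (by norm_num)} : Set (GU K hd α₁ α₂)) ⊆ GU.homog hd α₁ α₂ 3 := by
    rintro _ (rfl | rfl | rfl) <;> exact GU.w_mem_homog _ (by norm_num)
  have h20 : ({GU.w hd α₁ α₂ 2 0 1 (by norm_num), GU.w hd α₁ α₂ 1 1 0 (by norm_num)} :
      Set (GU K hd α₁ α₂)) ⊆ GU.homog hd α₁ α₂ 2 := by
    rintro _ (rfl | rfl) <;> exact GU.w_mem_homog _ (by norm_num)
  have h4 : ∀ f : GU K hd α₁ α₂, GU.consequences f 4 = ⊥ := fun f => by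
    rw [GU.consequences, GU.homog_eq_bot hα le_rfl, inf_bot_eq]
  exact ⟨fun n hn => GU.homog_eq_bot hα hn,
    GU.equivalent_consequences GU.homog_two_le_tIdeal_w1 h20 GU.homog_two_le_tIdeal,
    GU.equivalent_consequences GU.homog_three_le_tIdeal_w20 h30 (GU.homog_three_le_tIdeal h₂),
    GU.equivalent_consequences (GU.homog_three_le_tIdeal_w11 h₃) h30
      (GU.homog_three_le_tIdeal h₂),
    fun n hn f hf => GU.homog_le_of_hasDegree h₃ hn hf, h4 _, fun _ _ _ => h4 _⟩
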